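/- **Theorem 20.1 (Basterfield–Kelly).** Let $L$ be a finite geometric lattice of rank $d$, that is, a finite lattice in which every element is a join of points (elements covering $0$; the element $0$ is the empty join) and which is semimodular: whenever $a$ covers $a\wedge b$, the element $a\vee b$ covers $b$. The rank of an element is the maximum length of a chain ending at it (a chain of $n+1$ elements has length $n$), and $d$ is the rank of $1$. Let $W_k$ denote the number of elements of $L$ of rank $k$, so that for $d\ge 1$ the number of points is $W_1$ and the number of hyperplanes (elements covered by $1$) is $W_{d-1}$; for $d=0$ put $W_{-1}=0$. Then $W_1=W_{d-1}$ if and only if $L$ is modular, i.e. $a\vee(b\wedge c)=(a\vee b)\wedge c$ for all $a,b,c\in L$ with $a\le c$. -/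

import Mathlib

/-- A geometric lattice: a semimodular lattice (`b ⋖ a ⊔ b` whenever `a ⊓ b ⋖ a`) in which every
element is a join of points, that is, of atoms (the bottom element being the empty join). -/
class IsGeometricLattice (L : Type*) [Lattice L] [OrderBot L] : Prop
    extends IsUpperModularLattice L, IsAtomistic L

/-- The number `W_k` of elements of rank `k`. The rank of `x` is `Order.height x`, the maximal
length (number of steps) of a chain ending at `x`. The index is an integer, so that `W_{d-1}` also
makes sense for `d = 0`, where it counts nothing. -/
noncomputable def whitneyNumber (L : Type*) [Preorder L] (k : ℤ) : ℕ :=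
  Set.ncard {x : L | ∃ n : ℕ, (n : ℤ) = k ∧ Order.height x = (n : ℕ∞)}

/-! Call atoms points and coatoms hyperplanes. If a point `p` is off a hyperplane `H`, joining with
`p` injects the points on `H` into the lines through `p`. By induction on the interval above `p`,
these are at most as many as the hyperplanes through `p`. Double counting non-incident pairs, as for
de Bruijn–Erdős, then gives at least as many hyperplanes as points. If the numbers agree, the
counting forces equality throughout, so the injection is onto: every line through `p` is spanned by
`p` and a point of `H`. This makes the lattice lower semimodular, and with upper semimodularity the
rank function yields modularity. Conversely, the dual of a modular geometric lattice is geometric,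
and the inequality applied to it is the reverse one. -/

open Finset in
/-- The double-counting lemma behind the theorem of de Bruijn and Erdős: if non-incidence of `a` and
`b` forces `a` to have at least as large a degree as `b`, and there are at least as many `a` as `b`,
then the degrees of non-incident elements are proportional. -/
theorem card_mul_degree_eq_of_not_incident {α β : Type*} [Finite α] [Finite β] (r : α → β → Prop)
    (hα : ∀ a, ∃ b, ¬ r a b) (hβ : ∀ b, ∃ a, ¬ r a b)
    (h : ∀ a b, ¬ r a b → Nat.card {a' // r a' b} ≤ Nat.card {b' // r a b'})
    (hle : Nat.card β ≤ Nat.card α) (a : α) (b : β) (hab : ¬ r a b) :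
    Nat.card α * Nat.card {b' // r a b'} = Nat.card β * Nat.card {a' // r a' b} := by
  classical
  have := Fintype.ofFinite α
  have := Fintype.ofFinite β
  simp only [Nat.card_eq_fintype_card, Fintype.card_subtype] at *
  have hd (a : α) : #{b | r a b} + #{b | ¬ r a b} = Fintype.card β :=
    card_filter_add_card_filter_not _
  have hk (b : β) : #{a | r a b} + #{a | ¬ r a b} = Fintype.card α :=
    card_filter_add_card_filter_not _
  have hd0 (a : α) : (0 : ℚ) < #{b | ¬ r a b} := by
    obtain ⟨b, hb⟩ := hα a
    exact_mod_cast card_pos.2 ⟨b, by simpa using hb⟩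
  have hk0 (b : β) : (0 : ℚ) < #{a | ¬ r a b} := by
    obtain ⟨a, ha⟩ := hβ b
    exact_mod_cast card_pos.2 ⟨a, by simpa using ha⟩
  -- Weights on non-incident pairs: `f` sums to `|α|` over each `b` and `g` to `|β|` over each `a`,
  -- so the totals agree. As `f ≤ g` termwise, they coincide.
  let f (x : α × β) : ℚ := if r x.1 x.2 then 0 else Fintype.card α / #{a | ¬ r a x.2}
  let g (x : α × β) : ℚ := if r x.1 x.2 then 0 else Fintype.card β / #{b | ¬ r x.1 b}
  have hf : ∑ x, f x = Fintype.card α * Fintype.card β := by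
    rw [Fintype.sum_prod_type_right]
    have (b : β) : ∑ a, f (a, b) = Fintype.card α := by
      simp only [f, ← ite_not (r _ _), ← sum_filter, sum_const, nsmul_eq_mul]
      exact mul_div_cancel₀ _ (hk0 b).ne'
    simp [this, mul_comm]
  have hg : ∑ x, g x = Fintype.card α * Fintype.card β := by
    rw [Fintype.sum_prod_type]
    have (a : α) : ∑ b, g (a, b) = Fintype.card β := by
      simp only [g, ← ite_not (r _ _), ← sum_filter, sum_const, nsmul_eq_mul]
      exact mul_div_cancel₀ _ (hd0 a).ne'
    simp [this]
  have hfg : ∀ x ∈ univ, f x ≤ g x := by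
    rintro ⟨a, b⟩ -
    by_cases hr : r a b
    · simp [f, g, hr]
    · simp only [f, g, hr, if_false]
      rw [div_le_div_iff₀ (hk0 b) (hd0 a)]
      have h1 := Nat.mul_le_mul hle (h a b hr)
      have h2 := hd a
      have h3 := hk b
      norm_cast
      nlinarith
  have key := (sum_eq_sum_iff_of_le hfg).1 (hf.trans hg.symm) (a, b) (mem_univ _)
  simp only [f, g, hab, if_false] at key
  rw [div_eq_div_iff (hk0 b).ne' (hd0 a).ne'] at key
  norm_cast at key
  have h2 := hd a
  have h3 := hk b
  nlinarith

/-! ### Rank in semimodular lattices -/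

section Rank

variable {L : Type*}

/-- There is a saturated chain of length `n` from `a` to `b`. -/
def CoverChain [Preorder L] : ℕ → L → L → Prop
  | 0, a, b => a = b
  | n + 1, a, b => ∃ c, a ⋖ c ∧ CoverChain n c b

theorem CoverChain.le [Preorder L] {n : ℕ} : ∀ {a b : L}, CoverChain n a b → a ≤ b := by
  induction n with
  | zero => rintro a _ rfl; exact le_rfl
  | succ n ih => rintro a b ⟨c, hac, hcb⟩; exact hac.le.trans (ih hcb)

theorem CoverChain.snoc [Preorder L] {n : ℕ} {c : L} :
    ∀ {a b : L}, CoverChain n a b → b ⋖ c → CoverChain (n + 1) a c := by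
  induction n with
  | zero => rintro a _ rfl h; exact ⟨c, h, rfl⟩
  | succ n ih => rintro a b ⟨x, hax, hxb⟩ h; exact ⟨x, hax, ih hxb h⟩

theorem exists_coverChain [PartialOrder L] [Finite L] {a b : L} (h : a ≤ b) :
    ∃ n, CoverChain n a b := by
  induction a using WellFoundedGT.induction with
  | ind a ih =>
    obtain rfl | hlt := h.eq_or_lt
    · exact ⟨0, rfl⟩
    · obtain ⟨c, hac, hcb⟩ := exists_covBy_le_of_lt hlt
      obtain ⟨n, hn⟩ := ih c hac.lt hcb
      exact ⟨n + 1, c, hac, hn⟩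

/-- The Jordan–Dedekind chain condition. -/
theorem CoverChain.length_unique [Lattice L] [IsUpperModularLattice L] [Finite L] {n : ℕ} :
    ∀ {m : ℕ} {a b : L}, CoverChain n a b → CoverChain m a b → n = m := by
  induction n with
  | zero =>
    rintro (_ | m) a _ rfl hm
    · rfl
    · obtain ⟨c, hac, hca⟩ := hm
      exact (hac.lt.not_ge hca.le).elim
  | succ n ih =>
    rintro (_ | m) a b ⟨c, hac, hcb⟩ hm
    · obtain rfl : a = b := hm
      exact (hac.lt.not_ge hcb.le).elim
    · obtain ⟨c', hac', hcb'⟩ := hm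
      obtain rfl | hne := eq_or_ne c c'
      · rw [ih hcb hcb']
      · have hinf : c ⊓ c' = a := by
          refine (hac.eq_or_eq (le_inf hac.le hac'.le) inf_le_left).resolve_right fun h => ?_
          have hcc' : c ≤ c' := inf_eq_left.1 h
          exact hac'.2 hac.lt (hcc'.lt_of_ne hne)
        obtain ⟨k, hk⟩ := exists_coverChain (sup_le hcb.le hcb'.le)
        -- Both `c` and `c'` are covered by `c ⊔ c'`, so the two chains are compared through chains
        -- passing through this join.
        have h1 := ih (m := k + 1) hcb ⟨_, covBy_sup_of_inf_covBy_right (hinf ▸ hac'), hk⟩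
        have hk' : CoverChain n c' b :=
          h1 ▸ ⟨_, covBy_sup_of_inf_covBy_left (hinf ▸ hac), hk⟩
        rw [ih hk' hcb']

theorem CoverChain.of_height [PartialOrder L] [OrderBot L] {n : ℕ} :
    ∀ {a : L}, Order.height a = n → CoverChain n ⊥ a := by
  induction n with
  | zero =>
    intro a h
    exact (isMin_iff_eq_bot.1 (Order.height_eq_zero.1 h)).symm
  | succ n ih =>
    intro a h
    obtain ⟨-, ⟨x, hxa, hx⟩, -⟩ := Order.height_eq_coe_add_one_iff.1 (by exact_mod_cast h)
    refine (ih hx).snoc ⟨hxa, fun y hxy hya => ?_⟩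
    have h1 := Order.height_add_one_le hxy
    have h2 := Order.height_add_one_le hya
    have h3 := (add_le_add_left h1 1).trans h2
    rw [hx, h] at h3
    norm_cast at h3
    omega

theorem exists_height_eq_coe [PartialOrder L] [Finite L] (a : L) :
    ∃ n : ℕ, Order.height a = n := by
  have := Fintype.ofFinite L
  refine ⟨_, (ENat.natCast_toNat
    (ne_top_of_le_ne_top (ENat.natCast_ne_top (Fintype.card L)) ?_)).symm⟩
  exact Order.height_le fun p _ => by exact_mod_cast p.length_lt_card.le

theorem height_eq_height_add_one_of_covBy [Lattice L] [OrderBot L] [IsUpperModularLattice L]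
    [Finite L] {a b : L} (h : a ⋖ b) : Order.height b = Order.height a + 1 := by
  obtain ⟨n, hn⟩ := exists_height_eq_coe a
  obtain ⟨m, hm⟩ := exists_height_eq_coe b
  rw [hn, hm, (CoverChain.of_height hm).length_unique ((CoverChain.of_height hn).snoc h)]
  push_cast
  rfl

theorem height_eq_one_iff_isAtom [PartialOrder L] [OrderBot L] [Finite L] {a : L} :
    Order.height a = 1 ↔ IsAtom a := by
  constructor
  · intro h
    obtain ⟨c, hc, hca⟩ := CoverChain.of_height (n := 1) (by exact_mod_cast h)
    obtain rfl : c = a := hca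
    exact bot_covBy_iff.1 hc
  · intro h
    have : Order.height a = ((0 : ℕ) : ℕ∞) + 1 := by
      refine Order.height_eq_coe_add_one_iff.2 ⟨?_, ⟨⊥, h.bot_lt, by simp⟩, fun y hy => ?_⟩
      · obtain ⟨n, hn⟩ := exists_height_eq_coe a
        simp [hn]
      · simp [h.2 y hy]
    simpa using this

theorem height_add_one_eq_height_top_iff_isCoatom [Lattice L] [BoundedOrder L]
    [IsUpperModularLattice L] [Finite L] {a : L} :
    Order.height a + 1 = Order.height (⊤ : L) ↔ IsCoatom a := by
  refine ⟨fun h => ?_, fun h => (height_eq_height_add_one_of_covBy h.covBy_top).symm⟩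
  obtain ⟨n, hn⟩ := exists_height_eq_coe a
  refine ⟨?_, fun b hb => ?_⟩
  · rintro rfl
    rw [hn] at h
    norm_cast at h
    omega
  · by_contra hne
    have h1 := Order.height_add_one_le hb
    have h2 := Order.height_add_one_le (lt_top_iff_ne_top.2 hne)
    have h3 := (add_le_add_left h1 1).trans h2
    rw [← h, hn] at h3
    norm_cast at h3
    omega

/-- A finite lattice that is both upper and lower semimodular is modular. -/
theorem IsModularLattice.of_isUpperModularLattice_of_isLowerModularLattice [Lattice L] [OrderBot L]
    [Finite L] [IsUpperModularLattice L] [IsLowerModularLattice L] : IsModularLattice L := by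
  choose f hf using exists_height_eq_coe (L := L)
  have hmono : Monotone f := fun a b h => by
    have := Order.height_mono h
    rw [hf, hf] at this
    exact_mod_cast this
  have hstrict {a b : L} (h : a < b) : f a < f b := by
    have := Order.height_add_one_le h
    rw [hf, hf] at this
    exact_mod_cast this
  have hcov {a b : L} (h : a ⋖ b) : f b = f a + 1 := by
    have := height_eq_height_add_one_of_covBy h
    rw [hf, hf] at this
    exact_mod_cast this
  have hcov' {a b : L} (h : a ⩿ b) : f b ≤ f a + 1 := by
    obtain h | rfl := wcovBy_iff_covBy_or_eq.1 h
    · exact (hcov h).le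
    · omega
  -- Along a saturated chain, joining or (in `hinf`) meeting with `z` raises the rank by at most one
  -- per step.
  have hsup (z : L) {n : ℕ} : ∀ {a b : L}, CoverChain n a b → f (b ⊔ z) + f a ≤ f b + f (a ⊔ z) := by
    induction n with
    | zero => rintro a _ rfl; omega
    | succ n ih =>
      rintro a b ⟨c, hac, hcb⟩
      have h1 := ih hcb
      have h2 := hcov hac
      have h3 : f (c ⊔ z) ≤ f (a ⊔ z) + 1 := by
        by_cases hz : c ≤ a ⊔ z
        · have : c ⊔ z ≤ a ⊔ z := sup_le hz le_sup_right
          exact (hmono this).trans (Nat.le_succ _)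
        · have hinf : c ⊓ (a ⊔ z) = a :=
            (hac.eq_or_eq (le_inf hac.le le_sup_left) inf_le_left).resolve_right
              fun h => hz (inf_eq_left.1 h)
          have := covBy_sup_of_inf_covBy_left (a := c) (b := a ⊔ z) (hinf.symm ▸ hac)
          rw [← sup_assoc, sup_eq_left.2 hac.le] at this
          exact (hcov this).le
      omega
  have hinf (z : L) {n : ℕ} : ∀ {a b : L}, CoverChain n a b → f (b ⊓ z) + f a ≤ f b + f (a ⊓ z) := by
    induction n with
    | zero => rintro a _ rfl; omega
    | succ n ih =>
      rintro a b ⟨c, hac, hcb⟩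
      have h1 := ih hcb
      have h2 := hcov hac
      have h3 : f (c ⊓ z) ≤ f (a ⊓ z) + 1 := by
        by_cases hz : c ⊓ z ≤ a
        · have : c ⊓ z ≤ a ⊓ z := le_inf hz inf_le_right
          exact (hmono this).trans (Nat.le_succ _)
        · have hsup : a ⊔ (c ⊓ z) = c :=
            (hac.eq_or_eq le_sup_left (sup_le hac.le inf_le_left)).resolve_left
              fun h => hz (sup_eq_left.1 h)
          have := inf_covBy_of_covBy_sup_left (a := a) (b := c ⊓ z) (hsup.symm ▸ hac)
          rw [← inf_assoc, inf_eq_left.2 hac.le] at this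
          exact (hcov this).le
      omega
  refine ⟨fun {a} b {c} hac => ?_⟩
  have hle : a ⊔ b ⊓ c ≤ (a ⊔ b) ⊓ c := le_inf (sup_le_sup_left inf_le_left _)
    (sup_le hac inf_le_right)
  by_contra hne
  have hlt := hstrict (hle.lt_of_not_ge hne)
  set x := a ⊔ b ⊓ c
  set y := (a ⊔ b) ⊓ c
  have hxy : x ⊓ b = y ⊓ b := by
    refine le_antisymm (inf_le_inf_right _ hle) (le_inf ?_ inf_le_right)
    exact (le_inf inf_le_right (inf_le_left.trans inf_le_right)).trans le_sup_right
  have hxy' : x ⊔ b = y ⊔ b := by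
    refine le_antisymm (sup_le_sup_right hle _) (sup_le ?_ le_sup_right)
    exact inf_le_left.trans (sup_le_sup_right le_sup_left _)
  -- Now `x < y` have the same meet and the same join with `b`; the two rank inequalities give `f y
  -- ≤ f x`.
  obtain ⟨n, hn⟩ := exists_coverChain (inf_le_right : x ⊓ b ≤ b)
  obtain ⟨m, hm⟩ := exists_coverChain (le_sup_left : y ≤ y ⊔ b)
  have h1 := hsup x hn
  have h2 := hinf b hm
  rw [sup_comm b x, sup_eq_right.2 (inf_le_left : x ⊓ b ≤ x)] at h1
  rw [inf_eq_right.2 (le_sup_right : b ≤ y ⊔ b)] at h2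
  rw [hxy, hxy'] at h1
  omega

end Rank

/-! ### Points, lines and hyperplanes -/

section Geometric

variable {L : Type*} [Lattice L]

/-- In an upper semimodular lattice, joining with an atom is a covering or does nothing. -/
theorem covBy_sup_of_isAtom [OrderBot L] [IsUpperModularLattice L] {p a : L} (hp : IsAtom p)
    (h : ¬ p ≤ a) : a ⋖ p ⊔ a := by
  refine covBy_sup_of_inf_covBy_left ?_
  rw [(hp.le_iff.1 inf_le_left).resolve_right fun he => h (inf_eq_left.1 he)]
  exact hp.bot_covBy

theorem eq_sup_of_covBy_of_isAtom {a b p : L} (hab : a ⋖ b) (hpb : p ≤ b) (hpa : ¬ p ≤ a) :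
    p ⊔ a = b :=
  (hab.eq_or_eq le_sup_right (sup_le hpb hab.le)).resolve_left fun h => hpa (sup_eq_right.1 h)

theorem exists_isAtom_le_not_le [OrderBot L] [IsAtomistic L] {a b : L} (h : ¬ a ≤ b) :
    ∃ p, IsAtom p ∧ p ≤ a ∧ ¬ p ≤ b := by
  by_contra! hab
  exact h (le_iff_atom_le_imp.2 hab)

instance Set.Ici.isGeometricLattice [OrderBot L] [IsGeometricLattice L] (p : L) :
    IsGeometricLattice (Set.Ici p) where
  covBy_sup_of_inf_covBy {a b} h := by
    have hc {x y : Set.Ici p} : x ⋖ y ↔ (x : L) ⋖ (y : L) := by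
      refine (Set.OrdConnected.apply_covBy_apply_iff
        (OrderEmbedding.subtype (· ∈ Set.Ici p)) ?_).symm
      simpa only [OrderEmbedding.coe_subtype, Subtype.range_coe_subtype] using!
        Set.ordConnected_Ici (a := p)
    exact hc.2 (covBy_sup_of_inf_covBy_left (hc.1 h))
  isLUB_atoms b := by
    refine ⟨{a | IsAtom a ∧ a ≤ b}, ⟨fun a ha => ha.2, fun c hc => ?_⟩, fun a ha => ha.1⟩
    change (b : L) ≤ c
    refine le_iff_atom_le_imp.2 fun q hq hqb => ?_
    by_cases hqp : q ≤ p
    · exact hqp.trans c.2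
    · have : (⟨q ⊔ p, le_sup_right⟩ : Set.Ici p) ≤ c :=
        hc ⟨Set.Ici.isAtom_iff.2 (covBy_sup_of_isAtom hq hqp), sup_le hqb b.2⟩
      exact le_sup_left.trans (show q ⊔ p ≤ c from this)

/-- The join with a point `p` off `H`, as a map from the points on `H` to the lines through `p`. -/
def joinPoint [OrderBot L] [IsUpperModularLattice L] {p H : L} (hp : IsAtom p)
    (hpH : ¬ p ≤ H)
    (q : {q : {q : L // IsAtom q} // q.1 ≤ H}) : {c : Set.Ici p // IsAtom c} :=
  ⟨⟨q.1.1 ⊔ p, le_sup_right⟩, Set.Ici.isAtom_iff.2 (covBy_sup_of_isAtom q.1.2 fun h =>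
    hpH ((hp.le_iff.1 h).resolve_left q.1.2.1 ▸ q.2))⟩

/-- Two distinct points of `H` on one line through `p` would span that line, putting `p` in `H`. -/
theorem joinPoint_injective [OrderBot L] [IsUpperModularLattice L] {p H : L} (hp : IsAtom p)
    (hpH : ¬ p ≤ H) :
    Function.Injective (joinPoint hp hpH) := by
  rintro ⟨⟨q, hq⟩, hqH⟩ ⟨⟨q', hq'⟩, hqH'⟩ h
  simp only [joinPoint, Subtype.mk.injEq] at h hqH hqH' ⊢
  by_contra hne
  have hqq' : ¬ q' ≤ q := fun hle => hne ((hq.le_iff.1 hle).resolve_left hq'.1).symm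
  have hpq : ¬ p ≤ q := fun hle => hpH (hle.trans hqH)
  have hcov : q ⋖ q ⊔ p := sup_comm p q ▸ covBy_sup_of_isAtom hp hpq
  have := eq_sup_of_covBy_of_isAtom hcov (le_sup_left.trans (congrArg Subtype.val h).ge) hqq'
  exact hpH ((le_sup_right.trans this.ge).trans (sup_le hqH' hqH))

theorem card_isCoatom_Ici [OrderTop L] (p : L) :
    Nat.card {K : Set.Ici p // IsCoatom K} = Nat.card {K : {K : L // IsCoatom K} // p ≤ K.1} :=
  Nat.card_congr
    { toFun := fun K => ⟨⟨K.1, K.2.of_isCoatom_coe_Ici⟩, K.1.2⟩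
      invFun := fun K => ⟨⟨K.1.1, K.2⟩, K.1.2.Ici K.2⟩
      left_inv := fun _ => rfl
      right_inv := fun _ => rfl }

theorem exists_isAtom_not_le_of_isCoatom [BoundedOrder L] [IsAtomistic L] {H : L}
    (hH : IsCoatom H) : ∃ p, IsAtom p ∧ ¬ p ≤ H := by
  obtain ⟨p, hp, -, h⟩ := exists_isAtom_le_not_le (a := ⊤) (b := H) fun h => hH.1 (top_le_iff.1 h)
  exact ⟨p, hp, h⟩

theorem whitneyNumber_one [OrderBot L] [Finite L] :
    whitneyNumber L 1 = Nat.card {p : L // IsAtom p} := by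
  rw [whitneyNumber, ← Nat.card_coe_set_eq]
  refine Nat.card_congr (Equiv.subtypeEquivRight fun a => ?_)
  rw [← height_eq_one_iff_isAtom]
  refine ⟨fun ⟨n, hn, ha⟩ => ?_, fun ha => ⟨1, rfl, by simpa using ha⟩⟩
  obtain rfl : n = 1 := by exact_mod_cast hn
  simpa using ha

variable [BoundedOrder L] [Finite L] [IsGeometricLattice L]

/-- Take `H ≥ a` maximal among elements not above `x`. Each point off `H` then joins with `H` to the
same cover `x ⊔ H`, which must be `⊤`. -/
theorem exists_isCoatom_le_not_le {a x : L} (h : ¬ x ≤ a) : ∃ H, IsCoatom H ∧ a ≤ H ∧ ¬ x ≤ H := by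
  obtain ⟨H, haH, hH⟩ := (Set.toFinite {H : L | ¬ x ≤ H}).exists_le_maximal h
  refine ⟨H, ⟨?_, fun y hy => ?_⟩, haH, hH.prop⟩
  · rintro rfl
    exact hH.prop le_top
  obtain ⟨q, hq, hqy, hqH⟩ := exists_isAtom_le_not_le (L := L) hy.not_ge
  have key (s : L) (hs : IsAtom s) (hsH : ¬ s ≤ H) : x ⊔ H = s ⊔ H := by
    have hcov := covBy_sup_of_isAtom hs hsH
    refine eq_sup_of_covBy_of_isAtom hcov ?_ hH.prop
    by_contra hx
    exact hcov.lt.not_ge (hH.2 hx hcov.le)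
  refine top_le_iff.1 (le_iff_atom_le_imp.2 fun s hs _ => ?_)
  by_cases hsH : s ≤ H
  · exact hsH.trans hy.le
  · exact le_sup_left.trans (((key s hs hsH).symm.trans (key q hq hqH)).le.trans
      (sup_le hqy hy.le))

theorem card_points_le_card_lines {p H : L} (hp : IsAtom p) (hpH : ¬ p ≤ H) :
    Nat.card {q : {q : L // IsAtom q} // q.1 ≤ H} ≤ Nat.card {c : Set.Ici p // IsAtom c} :=
  Nat.card_le_card_of_injective _ (joinPoint_injective hp hpH)

theorem exists_isCoatom_not_ge_of_isAtom {p : L} (hp : IsAtom p) : ∃ H, IsCoatom H ∧ ¬ p ≤ H := by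
  obtain ⟨H, hH, -, h⟩ := exists_isCoatom_le_not_le (a := ⊥) (x := p) fun h => hp.1 (le_bot_iff.1 h)
  exact ⟨H, hH, h⟩

/-- A finite geometric lattice has at least as many hyperplanes as points. -/
theorem card_isAtom_le_card_isCoatom (L : Type*) [Lattice L] [BoundedOrder L] [Finite L]
    [IsGeometricLattice L] : Nat.card {p : L // IsAtom p} ≤ Nat.card {H : L // IsCoatom H} := by
  induction hn : Nat.card L using Nat.strong_induction_on generalizing L with
  | _ n ih =>
  subst hn
  -- Rank one is separate: there no hyperplane contains the point, while the final contradiction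
  -- needs a positive degree.
  by_cases htop : IsAtom (⊤ : L)
  · have : Subsingleton {p : L // IsAtom p} := ⟨fun p q => Subtype.ext <|
      ((htop.le_iff.1 le_top).resolve_left p.2.1).trans
        ((htop.le_iff.1 le_top).resolve_left q.2.1).symm⟩
    have : Nonempty {H : L // IsCoatom H} := by
      obtain ⟨H, hH, -⟩ := exists_isCoatom_not_ge_of_isAtom htop
      exact ⟨⟨H, hH⟩⟩
    exact (Finite.card_le_one_iff_subsingleton.2 ‹_›).trans Nat.card_pos
  have hdeg (p : {p : L // IsAtom p}) (H : {H : L // IsCoatom H}) (hpH : ¬ p.1 ≤ H.1) :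
      Nat.card {q : {q : L // IsAtom q} // q.1 ≤ H.1} ≤
        Nat.card {K : {K : L // IsCoatom K} // p.1 ≤ K.1} := by
    refine (card_points_le_card_lines p.2 hpH).trans ?_
    rw [← card_isCoatom_Ici]
    refine ih _ ?_ (Set.Ici p.1) rfl
    exact Finite.card_subtype_lt (x := ⊥) fun h => p.2.1 (le_bot_iff.1 h)
  by_contra! hlt
  obtain ⟨p⟩ : Nonempty {p : L // IsAtom p} := (Nat.card_pos_iff.1 (by omega)).1
  obtain ⟨H, hH, hpH⟩ := exists_isCoatom_not_ge_of_isAtom p.2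
  have heq := card_mul_degree_eq_of_not_incident
    (fun (p : {p : L // IsAtom p}) (H : {H : L // IsCoatom H}) => p.1 ≤ H.1)
    (fun p => let ⟨H, hH, h⟩ := exists_isCoatom_not_ge_of_isAtom p.2; ⟨⟨H, hH⟩, h⟩)
    (fun H => let ⟨p, hp, h⟩ := exists_isAtom_not_le_of_isCoatom H.2; ⟨⟨p, hp⟩, h⟩)
    hdeg hlt.le p ⟨H, hH⟩ hpH
  have hle := hdeg p ⟨H, hH⟩ hpH
  obtain ⟨K, hK, hpK⟩ := (eq_top_or_exists_le_coatom p.1).resolve_left fun h => htop (h ▸ p.2)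
  have : Nonempty {K : {K : L // IsCoatom K} // p.1 ≤ K.1} := ⟨⟨K, hK⟩, hpK⟩
  have hpos : 0 < Nat.card {K : {K : L // IsCoatom K} // p.1 ≤ K.1} := Nat.card_pos
  nlinarith

/-- If there are as many points as hyperplanes, then every line meets every hyperplane. -/
theorem exists_isAtom_le_sup_eq_of_card_eq
    (h : Nat.card {p : L // IsAtom p} = Nat.card {H : L // IsCoatom H}) {p H c : L} (hp : IsAtom p)
    (hH : IsCoatom H) (hpH : ¬ p ≤ H) (hc : p ⋖ c) : ∃ q, q ≤ H ∧ q ⊔ p = c := by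
  have hdeg (p : {p : L // IsAtom p}) : Nat.card {c : Set.Ici p.1 // IsAtom c} ≤
      Nat.card {K : {K : L // IsCoatom K} // p.1 ≤ K.1} :=
    (card_isAtom_le_card_isCoatom _).trans_eq (card_isCoatom_Ici _)
  have heq := card_mul_degree_eq_of_not_incident
    (fun (p : {p : L // IsAtom p}) (H : {H : L // IsCoatom H}) => p.1 ≤ H.1)
    (fun p => let ⟨H, hH, h⟩ := exists_isCoatom_not_ge_of_isAtom p.2; ⟨⟨H, hH⟩, h⟩)
    (fun H => let ⟨p, hp, h⟩ := exists_isAtom_not_le_of_isCoatom H.2; ⟨⟨p, hp⟩, h⟩)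
    (fun p H hpH => (card_points_le_card_lines p.2 hpH).trans (hdeg p)) h.ge ⟨p, hp⟩ ⟨H, hH⟩ hpH
  have : Nonempty {p : L // IsAtom p} := ⟨⟨p, hp⟩⟩
  rw [← h] at heq
  -- With equal totals, `H` has as many points as `p` has hyperplanes, so the lines through `p`,
  -- squeezed between, are equally many.
  have heq' := Nat.eq_of_mul_eq_mul_left Nat.card_pos heq
  have hbij := (joinPoint_injective hp hpH).bijective_of_nat_card_le ((hdeg ⟨p, hp⟩).trans_eq heq')
  obtain ⟨q, hq⟩ := hbij.2 ⟨⟨c, hc.le⟩, Set.Ici.isAtom_iff.2 hc⟩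
  exact ⟨q.1.1, q.2, congrArg (fun c => (c.1 : L)) hq⟩

/-- If every line meets every hyperplane, then the lattice is lower semimodular. -/
theorem isLowerModularLattice_of_lines_meet_hyperplanes
    (h : ∀ {p H c : L}, IsAtom p → IsCoatom H → ¬ p ≤ H → p ⋖ c → ∃ q, q ≤ H ∧ q ⊔ p = c) :
    IsLowerModularLattice L where
  inf_covBy_of_covBy_sup {a b} hab := by
    have hba : ¬ b ≤ a := fun hle => hab.lt.ne (sup_eq_left.2 hle).symm
    obtain ⟨H, hH, haH, hbH⟩ := exists_isCoatom_le_not_le hba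
    have hinf : (a ⊔ b) ⊓ H = a :=
      (hab.eq_or_eq (le_inf le_sup_left haH) inf_le_left).resolve_right
        fun he => hbH (le_sup_right.trans (inf_eq_left.1 he))
    have hbinf : b ⊓ H = a ⊓ b := by
      rw [← hinf, inf_right_comm, inf_eq_right.2 (le_sup_right : b ≤ a ⊔ b)]
    obtain ⟨p, hp, hpb, hpH⟩ := exists_isAtom_le_not_le hbH
    have hpinf : ¬ p ≤ a ⊓ b := fun hle => hpH ((hle.trans inf_le_left).trans haH)
    suffices p ⊔ a ⊓ b = b by
      simpa only [this] using covBy_sup_of_isAtom hp hpinf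
    -- For a point `q ≠ p` of `b`, the line through `p` and `q` meets `H` inside `b ⊓ H = a ⊓ b`, so
    -- `q ≤ p ⊔ a ⊓ b`.
    refine le_antisymm (sup_le hpb inf_le_right) (le_iff_atom_le_imp.2 fun q hq hqb => ?_)
    by_cases hqp : q ≤ p
    · exact hqp.trans le_sup_left
    obtain ⟨s, hsH, hs⟩ := h hp hH hpH (covBy_sup_of_isAtom hq hqp)
    have hsb : s ≤ b := le_sup_left.trans (hs.le.trans (sup_le hqb hpb))
    have hqs : q ≤ s ⊔ p := hs ▸ le_sup_left
    exact hqs.trans (sup_le ((le_inf hsb hsH).trans (hbinf.le.trans le_sup_right)) le_sup_left)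

theorem isModularLattice_of_card_isAtom_eq
    (h : Nat.card {p : L // IsAtom p} = Nat.card {H : L // IsCoatom H}) : IsModularLattice L :=
  have := isLowerModularLattice_of_lines_meet_hyperplanes (L := L)
    (exists_isAtom_le_sup_eq_of_card_eq h)
  .of_isUpperModularLattice_of_isLowerModularLattice

theorem card_isAtom_eq_of_isModularLattice [IsModularLattice L] :
    Nat.card {p : L // IsAtom p} = Nat.card {H : L // IsCoatom H} := by
  refine (card_isAtom_le_card_isCoatom L).antisymm ?_
  -- Separation by hyperplanes makes every element a meet of hyperplanes.
  have : IsAtomistic Lᵒᵈ := ⟨fun b => by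
    refine ⟨{a | IsAtom a ∧ a ≤ b}, ⟨fun a ha => ha.2, fun c hc => ?_⟩, fun a ha => ha.1⟩
    by_contra hbc
    obtain ⟨H, hH, hbH, hcH⟩ :=
      exists_isCoatom_le_not_le (a := OrderDual.ofDual b) (x := OrderDual.ofDual c) hbc
    exact hcH (hc ⟨hH.dual, hbH⟩)⟩
  have : IsGeometricLattice Lᵒᵈ := {}
  have := card_isAtom_le_card_isCoatom Lᵒᵈ
  have h1 : Nat.card {p : Lᵒᵈ // IsAtom p} = Nat.card {H : L // IsCoatom H} :=
    Nat.card_congr (OrderDual.ofDual.subtypeEquiv fun _ => isCoatom_dual_iff_isAtom.symm)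
  have h2 : Nat.card {p : Lᵒᵈ // IsCoatom p} = Nat.card {H : L // IsAtom H} :=
    Nat.card_congr (OrderDual.ofDual.subtypeEquiv fun _ => isAtom_dual_iff_isCoatom.symm)
  rwa [h1, h2] at this

theorem whitneyNumber_height_top_sub_one {d : ℕ} (hd : Order.height (⊤ : L) = d) :
    whitneyNumber L ((d : ℤ) - 1) = Nat.card {H : L // IsCoatom H} := by
  rw [whitneyNumber, ← Nat.card_coe_set_eq]
  refine Nat.card_congr (Equiv.subtypeEquivRight fun a => ?_)
  rw [← height_add_one_eq_height_top_iff_isCoatom, hd]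
  obtain ⟨m, hm⟩ := exists_height_eq_coe a
  simp only [Set.mem_ofPred_eq, hm]
  refine ⟨fun ⟨n, hn, ha⟩ => ?_, fun ha => ⟨m, ?_, rfl⟩⟩
  · obtain rfl : m = n := by exact_mod_cast ha
    have : m + 1 = d := by omega
    exact_mod_cast this
  · have : m + 1 = d := by exact_mod_cast ha
    omega

end Geometric

theorem theorem20p1 {L : Type*} [Lattice L] [BoundedOrder L] [Finite L] [IsGeometricLattice L]
    (d : ℕ) (hd : Order.height (⊤ : L) = (d : ℕ∞)) :
    whitneyNumber L 1 = whitneyNumber L ((d : ℤ) - 1) ↔ IsModularLattice L := by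
  rw [whitneyNumber_one, whitneyNumber_height_top_sub_one hd]
  exact ⟨isModularLattice_of_card_isAtom_eq, fun _ => card_isAtom_eq_of_isModularLattice⟩
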